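/- Consider a single bottleneck with capacity $\mu>0$ and $K$ groups of users with masses $Q_1,\dots,Q_K\ge 0$ and total mass $Q=\sum_k Q_k$, all sharing the preferred departure time $0$ from the bottleneck. The rush hour is a compact interval $\mathcal S\supseteq[-Q/\mu,\,Q/\mu]$. The schedule delay cost of group $k$ at departure time $s$ is $c_k(s)=\beta_k f^e(s)$ for $s\le 0$ and $c_k(s)=\gamma_k f^l(s)$ for $s\ge 0$, where $\beta_1>\dots>\beta_K>0$, $\gamma_1>\dots>\gamma_K>0$, $f^e$ is continuous and strictly decreasing on $(-\infty,0]$, $f^l$ is continuous and strictly increasing on $[0,\infty)$, and $f^e(0)=f^l(0)=0$. Put $\beta_{K+1}=\gamma_{K+1}=0$. Consider the linear program $$\min_{x\ge 0}\ \sum_{k}\int_{\mathcal S}c_k(s)x_k(s)\,ds\quad\text{subject to}\quad \sum_k x_k(s)\le\mu\ \ (s\in\mathcal S),\qquad \int_{\mathcal S}x_k(s)\,ds=Q_k\ \ (k=1,\dots,K)$$ over measurable flow rates $x=(x_1,\dots,x_K)$. An equilibrium is a triple $(x,b,v)$ of measurable flow rates $x_k\ge0$, a queuing delay $b\ge 0$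 on $\mathcal S$ and costs $v\in\mathbb R^K$ such that, for all $k$ and $s\in\mathcal S$: $v_k=b(s)+c_k(s)$ if $x_k(s)>0$ and $v_k\le b(s)+c_k(s)$ if $x_k(s)=0$; $\sum_k x_k(s)=\mu$ if $b(s)>0$ and $\sum_k x_k(s)\le\mu$ if $b(s)=0$; and $\int_{\mathcal S}x_k\,ds=Q_k$. Flow rates are regarded as densities: all pointwise conditions are required for almost every $s\in\mathcal S$, and uniqueness is up to null sets. For a flow pattern $x$ let $X_k^e=\int_{\mathcal S\cap(-\infty,0]}x_k\,ds$, $X_k^l=\int_{\mathcal S\cap(0,\infty)}x_k\,ds$, and, for $h\in\{e,l\}$, $s_k^h=\frac1\mu\sum_{k'\le k}X_{k'}^h$ $(0\le k\le K)$ and $T^h=\frac1\mu\sum_{k'=1}^{K}X_{k'}^h$. Then: 1. The linear program has an optimal solution $x^*$, it is unique, and a flow pattern is optimal if and only if it is the flow pattern of an equilibrium. 2. In $x^*$ all users of group $k$ depart in $[-s_k^e,-s_{k-1}^e]\cup[s_{k-1}^l,s_k^l]$, and $$-T^e=-s_K^e\le\dots\le-s_1^e\le -s_0^e=0=s_0^l\le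 s_1^l\le\dots\le s_K^l=T^l .$$ 3. If all these inequalities are strict, then for every $k=1,\dots,K$ the pair $(s_k^e,s_k^l)$ is the unique pair of nonnegative numbers satisfying $$s_k^e+s_k^l=\sum_{k'\le k}Q_{k'}/\mu,\qquad (\beta_k-\beta_{k+1})f^e(-s_k^e)=(\gamma_k-\gamma_{k+1})f^l(s_k^l),$$ and the common value in the second equation is $v_k-v_{k+1}$ (with $v_{K+1}=0$) for every equilibrium $(x^*,b,v)$. -/

import Mathlib

open MeasureTheory

namespace Bottleneck

/-- Schedule delay cost of group `k` at bottleneck-departure time `s`, the common preferred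
departure time being `0`: `β k * fe s` for early and `γ k * fl s` for late departures. (The two
branches agree at `s = 0` when `fe 0 = fl 0 = 0`.) -/
noncomputable def scheduleCost {K : ℕ} (β γ : Fin K → ℝ) (fe fl : ℝ → ℝ) (k : Fin K) (s : ℝ) : ℝ :=
  if s ≤ 0 then β k * fe s else γ k * fl s

/-- Feasible departure flow patterns of the linear program: `x k s` is the departure flow rate of
group `k` at time `s` in the rush hour `S`. Flow rates are densities, so that pointwise constraints
are imposed for almost every `s ∈ S`. -/
structure IsFeasible {K : ℕ} (S : Set ℝ) (μ : ℝ) (Q : Fin K → ℝ) (x : Fin K → ℝ → ℝ) : Prop where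
  measurable : ∀ k, AEMeasurable (x k) (volume.restrict S)
  nonneg : ∀ k, ∀ᵐ s ∂volume.restrict S, 0 ≤ x k s
  capacity : ∀ᵐ s ∂volume.restrict S, ∑ k, x k s ≤ μ
  conservation : ∀ k, ∫ s in S, x k s = Q k

/-- The objective of the linear program: total schedule delay cost. -/
noncomputable def totalCost {K : ℕ} (S : Set ℝ) (c : Fin K → ℝ → ℝ) (x : Fin K → ℝ → ℝ) : ℝ :=
  ∑ k, ∫ s in S, c k s * x k s

/-- Optimal solutions of the linear program. -/
def IsOptimal {K : ℕ} (S : Set ℝ) (μ : ℝ) (Q : Fin K → ℝ) (c : Fin K → ℝ → ℝ)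
    (x : Fin K → ℝ → ℝ) : Prop :=
  IsFeasible S μ Q x ∧ ∀ y, IsFeasible S μ Q y → totalCost S c x ≤ totalCost S c y

/-- Departure-time choice equilibrium with flow rates `x`, queuing delay `b` and equilibrium trip
costs `v`: nonnegative flows satisfying flow conservation, the queuing condition (the bottleneck
is saturated while there is a queue, and its capacity is never exceeded), and the users' optimal
choice condition (`v k` is the least trip cost, attained whenever group `k` departs). -/
structure IsEquilibrium {K : ℕ} (S : Set ℝ) (μ : ℝ) (Q : Fin K → ℝ) (c : Fin K → ℝ → ℝ)
    (x : Fin K → ℝ → ℝ) (b : ℝ → ℝ) (v : Fin K → ℝ) : Prop where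
  measurable : ∀ k, AEMeasurable (x k) (volume.restrict S)
  flow_nonneg : ∀ k, ∀ᵐ s ∂volume.restrict S, 0 ≤ x k s
  delay_nonneg : ∀ᵐ s ∂volume.restrict S, 0 ≤ b s
  choice_used : ∀ k, ∀ᵐ s ∂volume.restrict S, 0 < x k s → v k = b s + c k s
  choice_unused : ∀ k, ∀ᵐ s ∂volume.restrict S, x k s = 0 → v k ≤ b s + c k s
  queue : ∀ᵐ s ∂volume.restrict S, 0 < b s → ∑ k, x k s = μ
  no_queue : ∀ᵐ s ∂volume.restrict S, b s = 0 → ∑ k, x k s ≤ μ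
  conservation : ∀ k, ∫ s in S, x k s = Q k

/-- Mass of early users of group `k`. -/
noncomputable def earlyMass {K : ℕ} (S : Set ℝ) (x : Fin K → ℝ → ℝ) (k : Fin K) : ℝ :=
  ∫ s in S ∩ Set.Iic 0, x k s

/-- Mass of late users of group `k`. -/
noncomputable def lateMass {K : ℕ} (S : Set ℝ) (x : Fin K → ℝ → ℝ) (k : Fin K) : ℝ :=
  ∫ s in S ∩ Set.Ioi 0, x k s

/-- The breakpoint `s_i = (X_1 + ⋯ + X_i) / μ`, for `i = 0, …, K`, of a vector of masses
`X_1, …, X_K` (in Lean, `X 0, …, X (K - 1)`). Group `k : Fin K` lies between the breakpoints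
with indices `k.castSucc` and `k.succ`. -/
noncomputable def breakpoint {K : ℕ} (μ : ℝ) (X : Fin K → ℝ) (i : Fin (K + 1)) : ℝ :=
  (∑ k with k.castSucc < i, X k) / μ

/-- Breakpoints `s_i^e` of the early side of a flow pattern. -/
noncomputable def earlyBreak {K : ℕ} (S : Set ℝ) (μ : ℝ) (x : Fin K → ℝ → ℝ) :
    Fin (K + 1) → ℝ :=
  breakpoint μ (earlyMass S x)

/-- Breakpoints `s_i^l` of the late side of a flow pattern. -/
noncomputable def lateBreak {K : ℕ} (S : Set ℝ) (μ : ℝ) (x : Fin K → ℝ → ℝ) :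
    Fin (K + 1) → ℝ :=
  breakpoint μ (lateMass S x)

/-- The difference `w_k - w_{k+1}`, with the convention `w_{K+1} = 0`. -/
noncomputable def dropNext {K : ℕ} (w : Fin K → ℝ) (k : Fin K) : ℝ :=
  w k - if h : k.val + 1 < K then w ⟨k.val + 1, h⟩ else 0

end Bottleneck

/-!
The linear program is a semi-discrete transport problem: capacity is a continuum of equal time
slots, and each slot goes to the group `k` with the largest surplus `v k - c k s`, or stays unused
if all surpluses are negative. The queuing delay `b s` is the winning surplus, and the equilibrium
conditions are complementary slackness for the program and its dual in `(b, v)`.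

Existence comes from the dual. With `b` eliminated, its objective `dualValue` is continuous and,
since the rush hour is longer than the time needed to serve everybody, has a maximum
(`exists_dualValue_max`). Two groups, or a group and the empty slot, are tied only on a null set,
so the objective has partial derivatives (`hasDerivAt_dualValue`), and their vanishing at the
maximum says that each group wins exactly the time it needs. Letting the winners use the full
capacity gives an equilibrium (`exists_isEquilibrium`).

Given one equilibrium `(x, b, v)`, weak duality holds pointwise in time (`ClearsAt.reducedCost_le`),
so that no regularity of `b` is needed. It shows that equilibrium flows are optimal, that every
optimal flow forms an equilibrium with the same `(b, v)` (`IsOptimal.isEquilibrium`) and, ties being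
negligible, that the optimal flow is unique (`IsOptimal.ae_eq`).

On the late side the cost differences `c k - c j = (γ k - γ j) * fl` with `k < j` increase in time,
so the groups depart in the order of their indices, and there is a queue before every departure.
Hence the groups up to `k` fill the late slots up to their breakpoint
(`IsEquilibrium.late_support`). Just before the breakpoint after group `k` that group is willing to
travel, just after it the next one is, and continuity makes the difference of their costs equal to
`v k - v (k + 1)` there (`IsEquilibrium.dropNext_late`). Time reversal exchanges early and late
(`IsEquilibrium.reflect`), and monotonicity of `fe` and `fl` gives uniqueness of the pair of
breakpoints (`eq_of_balanced`).
-/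

namespace Bottleneck

/-! ### The dual problem -/

/-- The best surplus `v k - c k s` over the groups `k ∈ T`, or `0` if that is larger: the least
queuing delay at `s` that deters every group of `T` from beating the cost `v k`. -/
noncomputable def surplus {ι α : Type*} (c : ι → α → ℝ) (T : Finset ι) (v : ι → ℝ) (s : α) : ℝ :=
  T.fold max 0 fun k => v k - c k s

/-- The times at which group `k` bids strictly more than every other group and than `0`. -/
def winningSet {ι α : Type*} (c : ι → α → ℝ) (v : ι → ℝ) (k : ι) : Set α :=
  {s | 0 < v k - c k s ∧ ∀ j, j ≠ k → v j - c j s < v k - c k s}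

section Surplus

variable {ι α : Type*} {c : ι → α → ℝ} {T : Finset ι} {v w : ι → ℝ} {s : α}

lemma surplus_le_iff {a : ℝ} :
    surplus c T v s ≤ a ↔ 0 ≤ a ∧ ∀ k ∈ T, v k - c k s ≤ a :=
  Finset.fold_max_le a

lemma surplus_lt_iff {a : ℝ} :
    surplus c T v s < a ↔ 0 < a ∧ ∀ k ∈ T, v k - c k s < a :=
  Finset.fold_max_lt a

lemma surplus_nonneg : 0 ≤ surplus c T v s := (surplus_le_iff.1 le_rfl).1

lemma le_surplus {k : ι} (hk : k ∈ T) : v k - c k s ≤ surplus c T v s :=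
  (surplus_le_iff.1 le_rfl).2 k hk

lemma exists_eq_surplus (h : 0 < surplus c T v s) : ∃ k ∈ T, v k - c k s = surplus c T v s := by
  by_contra! hne
  exact lt_irrefl _ (surplus_lt_iff.2 ⟨h, fun k hk => lt_of_le_of_ne (le_surplus hk) (hne k hk)⟩)

lemma surplus_insert [DecidableEq ι] {k : ι} (hk : k ∉ T) :
    surplus c (insert k T) v s = max (v k - c k s) (surplus c T v s) :=
  Finset.fold_insert hk

lemma surplus_congr (h : ∀ k ∈ T, v k = w k) : surplus c T v s = surplus c T w s :=
  Finset.fold_congr fun k hk => by rw [h k hk]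

lemma surplus_le_add_norm [Fintype ι] : surplus c T v s ≤ surplus c T w s + ‖v - w‖ := by
  refine surplus_le_iff.2 ⟨add_nonneg surplus_nonneg (norm_nonneg _), fun k hk => ?_⟩
  have h1 : v k - w k ≤ ‖v - w‖ := (le_abs_self _).trans (norm_le_pi_norm (v - w) k)
  have h2 : w k - c k s ≤ surplus c T w s := le_surplus hk
  linarith

/-- Raising negative costs to `0` does not raise the surplus, since `c` is nonnegative. -/
lemma surplus_sup_zero_le (hc : ∀ k s, 0 ≤ c k s) :
    surplus c T (v ⊔ 0) s ≤ surplus c T v s := by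
  refine surplus_le_iff.2 ⟨surplus_nonneg, fun k hk => ?_⟩
  have h1 : v k - c k s ≤ surplus c T v s := le_surplus hk
  have h2 : 0 ≤ surplus c T v s := surplus_nonneg
  have h3 := hc k s
  rcases le_total (v k) 0 with h | h <;> simp [h] <;> linarith

lemma surplus_zero (hc : ∀ k s, 0 ≤ c k s) : surplus c T 0 s = 0 :=
  le_antisymm (surplus_le_iff.2 ⟨le_rfl, fun k _ => by simpa using hc k s⟩) surplus_nonneg

lemma surplus_of_mem_winningSet [Fintype ι] {k : ι} (h : s ∈ winningSet c v k) :
    surplus c Finset.univ v s = v k - c k s := by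
  refine le_antisymm (surplus_le_iff.2 ⟨h.1.le, fun j _ => ?_⟩) (le_surplus (Finset.mem_univ k))
  rcases eq_or_ne j k with rfl | hj
  exacts [le_rfl, (h.2 j hj).le]

lemma integrable_surplus [MeasurableSpace α] {ν : Measure α} [IsFiniteMeasure ν]
    (hc : ∀ k, Integrable (c k) ν) (T : Finset ι) (v : ι → ℝ) :
    Integrable (surplus c T v) ν := by
  classical
  induction T using Finset.induction_on with
  | empty => exact integrable_zero α ℝ ν
  | insert k T hk ih =>
    have : surplus c (insert k T) v = (fun s => v k - c k s) ⊔ surplus c T v := by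
      ext s
      exact surplus_insert hk
    rw [this]
    exact ((integrable_const _).sub (hc k)).sup ih

end Surplus

section Dual

variable {ι α : Type*} [Fintype ι] [MeasurableSpace α]

/-- The objective of the dual linear program, the queuing delay being eliminated as the
`surplus` of the costs `v`; capacity is normalised to `1`, so that `m k` is the time needed to
serve group `k`. -/
noncomputable def dualValue (c : ι → α → ℝ) (ν : Measure α) (m v : ι → ℝ) : ℝ :=
  ∑ k, v k * m k - ∫ s, surplus c Finset.univ v s ∂ν

lemma nullMeasurableSet_winningSet {c : ι → α → ℝ} {ν : Measure α}
    (hc : ∀ k, AEMeasurable (c k) ν) (v : ι → ℝ) (k : ι) :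
    NullMeasurableSet (winningSet c v k) ν := by
  have h : winningSet c v k = {s | 0 < v k - c k s} ∩
      ⋂ j, {s | j ≠ k → v j - c j s < v k - c k s} := by
    ext s; simp [winningSet]
  rw [h]
  refine (nullMeasurableSet_lt aemeasurable_const (aemeasurable_const.sub (hc k))).inter
    (NullMeasurableSet.iInter fun j => ?_)
  by_cases hj : j = k
  · simp [hj]
  · simpa [hj] using nullMeasurableSet_lt (aemeasurable_const.sub (hc j))
      (aemeasurable_const.sub (hc k))

variable {c : ι → α → ℝ} {ν : Measure α} [IsFiniteMeasure ν] {m : ι → ℝ}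

lemma continuous_dualValue (hc : ∀ k, Integrable (c k) ν) : Continuous (dualValue c ν m) := by
  refine Continuous.sub (by fun_prop) ?_
  refine (LipschitzWith.of_le_add_mul (ν.real Set.univ).toNNReal fun v w => ?_).continuous
  have h : ∫ s, surplus c Finset.univ v s ∂ν
      ≤ ∫ s, (surplus c Finset.univ w s + ‖v - w‖) ∂ν :=
    integral_mono (integrable_surplus hc _ v)
      ((integrable_surplus hc _ w).add (integrable_const _)) fun s => surplus_le_add_norm
  rw [integral_add (integrable_surplus hc _ w) (integrable_const _), integral_const] at h
  rwa [Real.coe_toNNReal _ measureReal_nonneg, dist_eq_norm]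

/-- The dual objective is coercive on the nonnegative orthant, as there is more time than is
needed to serve everybody; its maximum there is a maximum over all `v`. -/
lemma exists_dualValue_max (hc : ∀ k, Integrable (c k) ν) (hc0 : ∀ k s, 0 ≤ c k s)
    (hm : ∀ k, 0 ≤ m k) (hlt : ∑ k, m k < ν.real Set.univ) :
    ∃ v, ∀ w, dualValue c ν m w ≤ dualValue c ν m v := by
  set C := ∑ k, ∫ s, c k s ∂ν with hC
  set δ := ν.real Set.univ - ∑ k, m k with hδ
  have hδ0 : 0 < δ := sub_pos.2 hlt
  have hCk : ∀ k, 0 ≤ ∫ s, c k s ∂ν := fun k => integral_nonneg (hc0 k)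
  have hC0 : 0 ≤ C := Finset.sum_nonneg fun k _ => hCk k
  have hM : 0 ≤ C / δ := div_nonneg hC0 hδ0.le
  have hzero : dualValue c ν m 0 = 0 := by simp [dualValue, surplus_zero hc0]
  obtain ⟨v, hv, hmax⟩ := (isCompact_Icc (a := (0 : ι → ℝ)) (b := fun _ => C / δ)).exists_isMaxOn
    ⟨0, le_rfl, fun _ => hM⟩ (continuous_dualValue (m := m) hc).continuousOn
  have hv0 : 0 ≤ dualValue c ν m v := hzero ▸ hmax ⟨le_rfl, fun _ => hM⟩
  have hpos : ∀ w, 0 ≤ w → dualValue c ν m w ≤ dualValue c ν m v := by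
    intro w hw
    by_cases hwM : w ≤ fun _ => C / δ
    · exact hmax ⟨hw, hwM⟩
    · refine le_trans ?_ hv0
      obtain ⟨k₀, hk₀⟩ : ∃ k, C / δ < w k := by simpa [Pi.le_def] using hwM
      obtain ⟨k, -, hk⟩ := Finset.exists_max_image Finset.univ w ⟨k₀, Finset.mem_univ _⟩
      have hVM : C / δ < w k := hk₀.trans_le (hk k₀ (Finset.mem_univ _))
      have h1 : ∑ j, w j * m j ≤ w k * ∑ j, m j := by
        rw [Finset.mul_sum]
        exact Finset.sum_le_sum fun j hj => mul_le_mul_of_nonneg_right (hk j hj) (hm j)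
      have h2 : ∫ s, (w k - c k s) ∂ν ≤ ∫ s, surplus c Finset.univ w s ∂ν :=
        integral_mono ((integrable_const _).sub (hc k)) (integrable_surplus hc _ w)
          fun s => le_surplus (Finset.mem_univ k)
      rw [integral_sub (integrable_const _) (hc k), integral_const, smul_eq_mul] at h2
      have h3 : ∫ s, c k s ∂ν ≤ C :=
        Finset.single_le_sum (f := fun k => ∫ s, c k s ∂ν) (fun j _ => hCk j) (Finset.mem_univ k)
      have h4 : C < w k * δ := (div_lt_iff₀ hδ0).1 hVM
      rw [hδ, mul_sub] at h4
      unfold dualValue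
      linarith
  refine ⟨v, fun w => le_trans ?_ (hpos (w ⊔ 0) le_sup_right)⟩
  refine sub_le_sub (Finset.sum_le_sum fun k _ =>
    mul_le_mul_of_nonneg_right (le_max_left (w k) 0) (hm k)) ?_
  exact integral_mono (integrable_surplus hc _ _) (integrable_surplus hc _ _)
    fun s => surplus_sup_zero_le hc0

lemma hasDerivAt_max_sub {a b t : ℝ} (h : t - a ≠ b) :
    HasDerivAt (fun t => max (t - a) b) (if b < t - a then 1 else 0) t := by
  rcases lt_or_gt_of_ne h with h | h
  · rw [if_neg h.not_gt]
    refine (hasDerivAt_const t b).congr_of_eventuallyEq ?_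
    have : ∀ᶠ u in nhds t, u - a < b :=
      (continuous_id.sub continuous_const).continuousAt.eventually_lt continuousAt_const h
    filter_upwards [this] with u hu using max_eq_right hu.le
  · rw [if_pos h]
    refine ((hasDerivAt_id t).sub_const a).congr_of_eventuallyEq ?_
    have : ∀ᶠ u in nhds t, b < u - a :=
      continuousAt_const.eventually_lt (continuous_id.sub continuous_const).continuousAt h
    filter_upwards [this] with u hu using max_eq_left hu.le

/-- The partial derivative of the dual objective in `v k` is the excess of the time needed by
group `k` over the time it wins. Ties have measure zero, so the surplus is differentiable at
almost every time. -/
lemma hasDerivAt_dualValue [DecidableEq ι] (hc : ∀ k, Integrable (c k) ν)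
    (hnull : ∀ k w, ∀ᵐ s ∂ν, c k s ≠ w)
    (hnull₂ : ∀ k j, j ≠ k → ∀ w, ∀ᵐ s ∂ν, c k s - c j s ≠ w) (v : ι → ℝ) (k : ι) :
    HasDerivAt (fun t => dualValue c ν m (Function.update v k t))
      (m k - ν.real (winningSet c v k)) (v k) := by
  set B : α → ℝ := surplus c (Finset.univ.erase k) v with hB
  have hsur : ∀ t s, surplus c Finset.univ (Function.update v k t) s = max (t - c k s) (B s) := by
    intro t s
    rw [← Finset.insert_erase (Finset.mem_univ k), surplus_insert (Finset.notMem_erase k _)]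
    rw [Function.update_self, hB]
    congr 1
    exact surplus_congr fun j hj => Function.update_of_ne (Finset.ne_of_mem_erase hj) _ _
  have hBint : Integrable B ν := integrable_surplus hc _ _
  have hwin : ∀ s, s ∈ winningSet c v k ↔ B s < v k - c k s := by
    intro s
    rw [hB, surplus_lt_iff]
    simp [winningSet]
  refine HasDerivAt.sub ?_ ?_
  · have h := HasDerivAt.fun_sum (u := Finset.univ) (x := v k)
      (A := fun j t => Function.update v k t j * m j) (A' := fun j => if j = k then m k else 0) ?_
    · simpa using h
    · intro j _
      rcases eq_or_ne j k with rfl | hj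
      · simpa using (hasDerivAt_id (v j)).mul_const (m j)
      · simpa [hj] using hasDerivAt_const (v k) (v j * m j)
  · simp only [hsur]
    have hF : ∀ t, Integrable (fun s => max (t - c k s) (B s)) ν := fun t =>
      ((integrable_const t).sub (hc k)).sup hBint
    have hae : ∀ᵐ s ∂ν, v k - c k s ≠ B s := by
      filter_upwards [hnull k (v k), ae_all_iff.2 fun j => ae_all_iff.2 fun h : j ≠ k =>
        hnull₂ k j h (v k - v j)] with s h1 h2 heq
      rcases (surplus_nonneg : 0 ≤ B s).eq_or_lt with h0 | h0
      · exact h1 (by linarith)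
      · obtain ⟨j, hj, hjs⟩ := exists_eq_surplus h0
        exact h2 j (Finset.ne_of_mem_erase hj) (by rw [← hB] at hjs; linarith)
    have hind : (fun s => if B s < v k - c k s then (1 : ℝ) else 0)
        = (winningSet c v k).indicator fun _ => 1 := by
      classical
      ext s
      simp [Set.indicator_apply, hwin s]
    have key := (hasDerivAt_integral_of_dominated_loc_of_lip (μ := ν)
      (F := fun t s => max (t - c k s) (B s)) (x₀ := v k)
      (F' := fun s => if B s < v k - c k s then (1 : ℝ) else 0) (bound := fun _ => 1)
      Filter.univ_mem (Filter.Eventually.of_forall fun t => (hF t).aestronglyMeasurable)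
      (hF _) ?_ ?_ (integrable_const _) ?_).2
    · rw [hind, integral_indicator₀ (nullMeasurableSet_winningSet
        (fun k => (hc k).aemeasurable) v k)] at key
      simpa using key
    · rw [hind]
      exact (aestronglyMeasurable_const).indicator₀ (nullMeasurableSet_winningSet
        (fun k => (hc k).aemeasurable) v k)
    · refine Filter.Eventually.of_forall fun s => LipschitzWith.lipschitzOnWith ?_
      have : LipschitzWith 1 fun t : ℝ => t - c k s := by
        refine LipschitzWith.of_dist_le_mul fun x y => ?_
        simp
      simpa using this.max_const (B s)
    · filter_upwards [hae] with s hs using hasDerivAt_max_sub hs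

/-- There are costs `v` at which every group `k` outbids the others for exactly the time `m k`
that it needs. -/
theorem exists_winningSet_measure_eq (hc : ∀ k, Integrable (c k) ν) (hc0 : ∀ k s, 0 ≤ c k s)
    (hnull : ∀ k w, ∀ᵐ s ∂ν, c k s ≠ w)
    (hnull₂ : ∀ k j, j ≠ k → ∀ w, ∀ᵐ s ∂ν, c k s - c j s ≠ w)
    (hm : ∀ k, 0 ≤ m k) (hlt : 0 < ∑ k, m k → ∑ k, m k < ν.real Set.univ) :
    ∃ v, ∀ k, ν.real (winningSet c v k) = m k := by
  classical
  rcases (Finset.sum_nonneg fun k _ => hm k).eq_or_lt with h | h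
  · refine ⟨0, fun k => ?_⟩
    have h0 : m k = 0 := (Finset.sum_eq_zero_iff_of_nonneg fun k _ => hm k).1 h.symm k
      (Finset.mem_univ k)
    have : winningSet c 0 k = ∅ := by
      ext s
      simp [winningSet, (hc0 k s).not_gt]
    simp [this, h0]
  · obtain ⟨v, hv⟩ := exists_dualValue_max hc hc0 hm (hlt h)
    refine ⟨v, fun k => ?_⟩
    have hmax : IsLocalMax (fun t => dualValue c ν m (Function.update v k t)) (v k) :=
      Filter.Eventually.of_forall fun t => by simpa using hv _
    have := hmax.hasDerivAt_eq_zero (hasDerivAt_dualValue hc hnull hnull₂ v k)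
    linarith

end Dual

/-! ### Equilibria and duality -/

/-- The equilibrium conditions at a single time `s`. -/
structure ClearsAt {K : ℕ} (μ : ℝ) (c x : Fin K → ℝ → ℝ) (b : ℝ → ℝ) (v : Fin K → ℝ)
    (s : ℝ) : Prop where
  flow_nonneg : ∀ k, 0 ≤ x k s
  delay_nonneg : 0 ≤ b s
  le_cost : ∀ k, v k ≤ b s + c k s
  eq_cost : ∀ k, 0 < x k s → v k = b s + c k s
  capacity : ∑ k, x k s ≤ μ
  queue : 0 < b s → ∑ k, x k s = μ

section Clears

variable {K : ℕ} {S : Set ℝ} {μ : ℝ} {Q : Fin K → ℝ} {c x y : Fin K → ℝ → ℝ} {b : ℝ → ℝ}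
  {v : Fin K → ℝ}

lemma IsEquilibrium.ae_clearsAt (h : IsEquilibrium S μ Q c x b v) :
    ∀ᵐ s ∂volume.restrict S, ClearsAt μ c x b v s := by
  filter_upwards [ae_all_iff.2 h.flow_nonneg, h.delay_nonneg, ae_all_iff.2 h.choice_used,
    ae_all_iff.2 h.choice_unused, h.queue, h.no_queue] with s h1 h2 h3 h4 h5 h6
  refine ⟨h1, h2, fun k => ?_, h3, ?_, h5⟩
  · rcases (h1 k).eq_or_lt with h | h
    exacts [h4 k h.symm, (h3 k h).le]
  · rcases h2.eq_or_lt with h | h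
    exacts [h6 h.symm, (h5 h).le]

lemma IsEquilibrium.of_ae_clearsAt (hm : ∀ k, AEMeasurable (x k) (volume.restrict S))
    (hQ : ∀ k, ∫ s in S, x k s = Q k) (h : ∀ᵐ s ∂volume.restrict S, ClearsAt μ c x b v s) :
    IsEquilibrium S μ Q c x b v where
  measurable := hm
  flow_nonneg k := h.mono fun _ hs => hs.flow_nonneg k
  delay_nonneg := h.mono fun _ hs => hs.delay_nonneg
  choice_used k := h.mono fun _ hs => hs.eq_cost k
  choice_unused k := h.mono fun _ hs _ => hs.le_cost k
  queue := h.mono fun _ hs => hs.queue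
  no_queue := h.mono fun _ hs _ => hs.capacity
  conservation := hQ

lemma IsEquilibrium.isFeasible (h : IsEquilibrium S μ Q c x b v) : IsFeasible S μ Q x where
  measurable := h.measurable
  nonneg := h.flow_nonneg
  capacity := h.ae_clearsAt.mono fun _ hs => hs.capacity
  conservation := h.conservation

lemma IsFeasible.ae_le (h : IsFeasible S μ Q x) (k : Fin K) :
    ∀ᵐ s ∂volume.restrict S, x k s ≤ μ := by
  filter_upwards [ae_all_iff.2 h.nonneg, h.capacity] with s h1 h2
  exact (Finset.single_le_sum (f := fun k => x k s) (fun j _ => h1 j) (Finset.mem_univ k)).trans h2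

lemma IsFeasible.ae_norm_le (h : IsFeasible S μ Q x) (k : Fin K) :
    ∀ᵐ s ∂volume.restrict S, ‖x k s‖ ≤ μ := by
  filter_upwards [h.nonneg k, h.ae_le k] with s h1 h2
  rwa [Real.norm_of_nonneg h1]

lemma IsFeasible.integrable [IsFiniteMeasure (volume.restrict S)] (h : IsFeasible S μ Q x)
    (k : Fin K) : IntegrableOn (x k) S :=
  Integrable.of_bound (h.measurable k).aestronglyMeasurable μ (h.ae_norm_le k)

lemma IsFeasible.integrable_mul [IsFiniteMeasure (volume.restrict S)] (h : IsFeasible S μ Q x)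
    (k : Fin K) {f : ℝ → ℝ} (hf : IntegrableOn f S) : IntegrableOn (fun s => f s * x k s) S :=
  hf.mul_bdd (h.measurable k).aestronglyMeasurable (h.ae_norm_le k)

/-- Complementary slackness at a single time: the reduced cost `∑ k, (c k - v k) * y k` of
any admissible flow exceeds that of an equilibrium flow by a sum of nonnegative slack terms. -/
lemma ClearsAt.reducedCost_eq {s : ℝ} (h : ClearsAt μ c x b v s) :
    ∑ k, (c k s - v k) * y k s - ∑ k, (c k s - v k) * x k s
      = ∑ k, (b s + c k s - v k) * y k s + b s * (μ - ∑ k, y k s) := by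
  have h1 : ∀ k, (c k s - v k) * x k s = -(b s * x k s) := by
    intro k
    rcases (h.flow_nonneg k).eq_or_lt with h0 | h0
    · simp [← h0]
    · rw [h.eq_cost k h0]; ring
  have h2 : b s * ∑ k, x k s = b s * μ := by
    rcases h.delay_nonneg.eq_or_lt with h0 | h0
    · simp [← h0]
    · rw [h.queue h0]
  have h3 : ∑ k, (b s + c k s - v k) * y k s
      = ∑ k, (c k s - v k) * y k s + b s * ∑ k, y k s := by
    rw [Finset.mul_sum, ← Finset.sum_add_distrib]
    exact Finset.sum_congr rfl fun k _ => by ring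
  rw [h3]
  simp only [h1, Finset.sum_neg_distrib, ← Finset.mul_sum, h2]
  ring

lemma ClearsAt.slack_nonneg {s : ℝ} (h : ClearsAt μ c x b v s) (hy : ∀ k, 0 ≤ y k s) (k : Fin K) :
    0 ≤ (b s + c k s - v k) * y k s :=
  mul_nonneg (sub_nonneg.2 (h.le_cost k)) (hy k)

lemma ClearsAt.reducedCost_le {s : ℝ} (h : ClearsAt μ c x b v s) (hy : ∀ k, 0 ≤ y k s)
    (hcap : ∑ k, y k s ≤ μ) :
    ∑ k, (c k s - v k) * x k s ≤ ∑ k, (c k s - v k) * y k s := by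
  have h1 := h.reducedCost_eq (y := y)
  have h2 := Finset.sum_nonneg fun k (_ : k ∈ Finset.univ) => h.slack_nonneg hy k
  have h3 := mul_nonneg h.delay_nonneg (sub_nonneg.2 hcap)
  linarith

/-- A flow that attains the least reduced cost at `s` also clears the market there. -/
lemma ClearsAt.of_reducedCost_eq {s : ℝ} (h : ClearsAt μ c x b v s) (hy : ∀ k, 0 ≤ y k s)
    (hcap : ∑ k, y k s ≤ μ)
    (heq : ∑ k, (c k s - v k) * x k s = ∑ k, (c k s - v k) * y k s) :
    ClearsAt μ c y b v s := by
  have h1 := h.reducedCost_eq (y := y)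
  have h2 := Finset.sum_nonneg fun k (_ : k ∈ Finset.univ) => h.slack_nonneg hy k
  have h3 := mul_nonneg h.delay_nonneg (sub_nonneg.2 hcap)
  have h4 : ∑ k, (b s + c k s - v k) * y k s = 0 := by linarith
  have h5 : b s * (μ - ∑ k, y k s) = 0 := by linarith
  rw [Finset.sum_eq_zero_iff_of_nonneg fun k _ => h.slack_nonneg hy k] at h4
  refine ⟨hy, h.delay_nonneg, h.le_cost, fun k hk => ?_, hcap, fun hb => ?_⟩
  · have := (mul_eq_zero.1 (h4 k (Finset.mem_univ k))).resolve_right hk.ne'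
    linarith
  · have := (mul_eq_zero.1 h5).resolve_left hb.ne'
    linarith

/-- Where no two groups and no group and the zero queue are tied, an equilibrium flow is
determined by the queuing delay and the costs. -/
lemma ClearsAt.eq_flow {s : ℝ} (hx : ClearsAt μ c x b v s) (hy : ClearsAt μ c y b v s)
    (hne : ∀ k, c k s ≠ v k) (hne₂ : ∀ k j, j ≠ k → c k s - c j s ≠ v k - v j) (k : Fin K) :
    y k s = x k s := by
  have hbpos : ∀ j, v j = b s + c j s → 0 < b s := fun j hj =>
    lt_of_le_of_ne hx.delay_nonneg fun h0 => hne j (by linarith)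
  have single : ∀ z : Fin K → ℝ → ℝ, ClearsAt μ c z b v s → ∀ j, v j = b s + c j s →
      z j s = μ := by
    intro z hz j hj
    rw [← hz.queue (hbpos j hj)]
    refine (Finset.sum_eq_single (f := fun i => z i s) j (fun i _ hi => ?_)
      fun h => absurd (Finset.mem_univ j) h).symm
    refine le_antisymm (not_lt.1 fun h => hne₂ j i hi ?_) (hz.flow_nonneg i)
    have := hz.eq_cost i h
    linarith
  by_cases hk : v k = b s + c k s
  · rw [single x hx k hk, single y hy k hk]
  · rw [le_antisymm (not_lt.1 fun h => hk (hx.eq_cost k h)) (hx.flow_nonneg k),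
      le_antisymm (not_lt.1 fun h => hk (hy.eq_cost k h)) (hy.flow_nonneg k)]

variable [IsFiniteMeasure (volume.restrict S)]

lemma IsFeasible.integrable_reducedCost (hc : ∀ k, IntegrableOn (c k) S)
    (h : IsFeasible S μ Q y) (v : Fin K → ℝ) :
    IntegrableOn (fun s => ∑ k, (c k s - v k) * y k s) S :=
  integrable_finsetSum _ fun k _ => h.integrable_mul k ((hc k).sub (integrable_const _))

lemma IsFeasible.integral_reducedCost (hc : ∀ k, IntegrableOn (c k) S)
    (h : IsFeasible S μ Q y) (v : Fin K → ℝ) :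
    ∫ s in S, ∑ k, (c k s - v k) * y k s = totalCost S c y - ∑ k, v k * Q k := by
  have hint : ∀ k, IntegrableOn (fun s => (c k s - v k) * y k s) S := fun k =>
    h.integrable_mul k ((hc k).sub (integrable_const _))
  rw [integral_finsetSum _ fun k _ => hint k, totalCost, ← Finset.sum_sub_distrib]
  refine Finset.sum_congr rfl fun k _ => ?_
  simp only [sub_mul]
  rw [integral_sub (h.integrable_mul k (hc k)) ((h.integrable k).const_mul _),
    integral_const_mul, h.conservation k]

theorem IsEquilibrium.isOptimal (hc : ∀ k, IntegrableOn (c k) S)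
    (h : IsEquilibrium S μ Q c x b v) : IsOptimal S μ Q c x := by
  refine ⟨h.isFeasible, fun y hy => ?_⟩
  have key : ∫ s in S, ∑ k, (c k s - v k) * x k s ≤ ∫ s in S, ∑ k, (c k s - v k) * y k s := by
    refine integral_mono_ae (h.isFeasible.integrable_reducedCost hc v)
      (hy.integrable_reducedCost hc v) ?_
    filter_upwards [h.ae_clearsAt, ae_all_iff.2 hy.nonneg, hy.capacity] with s h1 h2 h3
      using h1.reducedCost_le h2 h3
  rw [h.isFeasible.integral_reducedCost hc, hy.integral_reducedCost hc] at key
  linarith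

/-- Delay and costs of one equilibrium support every optimal flow pattern. -/
theorem IsOptimal.isEquilibrium (hc : ∀ k, IntegrableOn (c k) S)
    (h : IsEquilibrium S μ Q c x b v) (hy : IsOptimal S μ Q c y) :
    IsEquilibrium S μ Q c y b v := by
  refine .of_ae_clearsAt hy.1.measurable hy.1.conservation ?_
  have hle : (fun s => ∑ k, (c k s - v k) * x k s) ≤ᵐ[volume.restrict S]
      fun s => ∑ k, (c k s - v k) * y k s := by
    filter_upwards [h.ae_clearsAt, ae_all_iff.2 hy.1.nonneg, hy.1.capacity] with s h1 h2 h3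
      using h1.reducedCost_le h2 h3
  have heq := (integral_eq_iff_of_ae_le (h.isFeasible.integrable_reducedCost hc v)
      (hy.1.integrable_reducedCost hc v) hle).1 (by
    rw [h.isFeasible.integral_reducedCost hc, hy.1.integral_reducedCost hc,
      le_antisymm ((h.isOptimal hc).2 y hy.1) (hy.2 x h.isFeasible)])
  filter_upwards [h.ae_clearsAt, ae_all_iff.2 hy.1.nonneg, hy.1.capacity, heq] with s h1 h2 h3 h4
    using h1.of_reducedCost_eq h2 h3 h4

theorem IsOptimal.ae_eq (hc : ∀ k, IntegrableOn (c k) S)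
    (hnull : ∀ k w, ∀ᵐ s ∂volume.restrict S, c k s ≠ w)
    (hnull₂ : ∀ k j, j ≠ k → ∀ w, ∀ᵐ s ∂volume.restrict S, c k s - c j s ≠ w)
    (h : IsEquilibrium S μ Q c x b v) (hy : IsOptimal S μ Q c y) (k : Fin K) :
    ∀ᵐ s ∂volume.restrict S, y k s = x k s := by
  filter_upwards [h.ae_clearsAt, (hy.isEquilibrium hc h).ae_clearsAt,
    ae_all_iff.2 fun k => hnull k (v k),
    ae_all_iff.2 fun k => ae_all_iff.2 fun j => ae_all_iff.2 fun hj : j ≠ k =>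
      hnull₂ k j hj (v k - v j)] with s h1 h2 h3 h4
  exact h1.eq_flow h2 h3 h4 k

/-- An equilibrium exists: every group uses the full capacity on the set that it wins at the
costs of `exists_winningSet_measure_eq`. -/
theorem exists_isEquilibrium (hμ : 0 < μ) (hc : ∀ k, IntegrableOn (c k) S)
    (hc0 : ∀ k s, 0 ≤ c k s)
    (hnull : ∀ k w, ∀ᵐ s ∂volume.restrict S, c k s ≠ w)
    (hnull₂ : ∀ k j, j ≠ k → ∀ w, ∀ᵐ s ∂volume.restrict S, c k s - c j s ≠ w)
    (hQ : ∀ k, 0 ≤ Q k) (hlt : 0 < ∑ k, Q k → (∑ k, Q k) / μ < volume.real S) :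
    ∃ x b v, IsEquilibrium S μ Q c x b v := by
  classical
  obtain ⟨v, hv⟩ := exists_winningSet_measure_eq (ν := volume.restrict S) (m := fun k => Q k / μ)
    hc hc0 hnull hnull₂ (fun k => div_nonneg (hQ k) hμ.le) (by
      rw [← Finset.sum_div, measureReal_restrict_apply_univ]
      exact fun h => hlt ((div_pos_iff_of_pos_right hμ).1 h))
  have hmeas : ∀ k, NullMeasurableSet (winningSet c v k) (volume.restrict S) :=
    nullMeasurableSet_winningSet (fun k => (hc k).aemeasurable) v
  refine ⟨fun k => (winningSet c v k).indicator fun _ => μ, surplus c Finset.univ v, v,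
    .of_ae_clearsAt (fun k => aemeasurable_const.indicator₀ (hmeas k)) (fun k => ?_) ?_⟩
  · rw [integral_indicator₀ (hmeas k), integral_const, measureReal_restrict_apply_univ, hv k,
      smul_eq_mul, div_mul_cancel₀ _ hμ.ne']
  · filter_upwards [ae_all_iff.2 fun k => hnull k (v k),
      ae_all_iff.2 fun k => ae_all_iff.2 fun j => ae_all_iff.2 fun hj : j ≠ k =>
        hnull₂ k j hj (v k - v j)] with s h1 h2
    have hsum : ∀ k, s ∈ winningSet c v k →
        ∑ j, (winningSet c v j).indicator (fun _ => μ) s = μ := by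
      intro k hk
      rw [Finset.sum_eq_single k (fun j _ hj => ?_) (by simp), Set.indicator_of_mem hk]
      exact Set.indicator_of_notMem (fun h => (hk.2 j hj).not_gt (h.2 k hj.symm)) _
    have hexists : 0 < surplus c Finset.univ v s → ∃ k, s ∈ winningSet c v k := by
      intro hpos
      obtain ⟨k, -, hk⟩ := exists_eq_surplus hpos
      refine ⟨k, by rwa [hk], fun j hj => lt_of_le_of_ne ?_ fun heq => h2 k j hj (by linarith)⟩
      rw [hk]
      exact le_surplus (Finset.mem_univ j)
    refine ⟨fun k => Set.indicator_nonneg (fun _ _ => hμ.le) s, surplus_nonneg, fun k => ?_,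
      fun k hk => ?_, ?_, fun hpos => ?_⟩
    · have : v k - c k s ≤ surplus c Finset.univ v s := le_surplus (Finset.mem_univ k)
      linarith
    · have hmem : s ∈ winningSet c v k := Set.mem_of_indicator_ne_zero hk.ne'
      rw [surplus_of_mem_winningSet hmem]
      ring
    · by_cases hex : ∃ k, s ∈ winningSet c v k
      · obtain ⟨k, hk⟩ := hex
        exact (hsum k hk).le
      · push Not at hex
        simp [hex, hμ.le]
    · obtain ⟨k, hk⟩ := hexists hpos
      exact hsum k hk

end Clears

/-! ### Sorting on the late side -/

section Breakpoint

variable {K : ℕ} {μ : ℝ} {X : Fin K → ℝ}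

lemma breakpoint_zero : breakpoint μ X 0 = 0 := by simp [breakpoint]

lemma breakpoint_last : breakpoint μ X (Fin.last K) = (∑ k, X k) / μ := by
  simp [breakpoint, Fin.castSucc_lt_last]

lemma breakpoint_succ (k : Fin K) : breakpoint μ X k.succ = (∑ j ∈ Finset.Iic k, X j) / μ := by
  unfold breakpoint
  congr 2
  ext j
  simp [Fin.castSucc_lt_succ_iff]

lemma breakpoint_castSucc (k : Fin K) :
    breakpoint μ X k.castSucc = (∑ j ∈ Finset.Iio k, X j) / μ := by
  unfold breakpoint
  congr 2
  ext j
  simp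

lemma breakpoint_succ_eq_add (k : Fin K) :
    breakpoint μ X k.succ = breakpoint μ X k.castSucc + X k / μ := by
  rw [breakpoint_succ, breakpoint_castSucc, ← Finset.Iio_insert, Finset.sum_insert (by simp)]
  ring

lemma monotone_breakpoint (hμ : 0 < μ) (hX : ∀ k, 0 ≤ X k) : Monotone (breakpoint μ X) := by
  intro i j hij
  refine div_le_div_of_nonneg_right ?_ hμ.le
  refine Finset.sum_le_sum_of_subset_of_nonneg (fun k hk => ?_) fun k _ _ => hX k
  simp only [Finset.mem_filter, Finset.mem_univ, true_and] at hk ⊢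
  exact hk.trans_le hij

end Breakpoint

section Late

variable {K : ℕ} {μ : ℝ} {Q γ : Fin K → ℝ} {c x : Fin K → ℝ → ℝ} {b f : ℝ → ℝ}
  {v : Fin K → ℝ} {lo hi : ℝ}

/-- Late users are sorted: groups with a smaller delay penalty depart later. -/
lemma ClearsAt.le_of_pos_of_pos (hγ : StrictAnti γ) (hf : StrictMonoOn f (Set.Ici 0))
    (hc : ∀ k s, 0 ≤ s → c k s = γ k * f s) {s t : ℝ} (hs0 : 0 ≤ s) (ht0 : 0 ≤ t)
    (hs : ClearsAt μ c x b v s) (ht : ClearsAt μ c x b v t) {k j : Fin K} (hkj : k < j)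
    (hk : 0 < x k s) (hj : 0 < x j t) : s ≤ t := by
  by_contra! hlt
  have h1 := hs.eq_cost k hk
  have h2 := hs.le_cost j
  have h3 := ht.eq_cost j hj
  have h4 := ht.le_cost k
  rw [hc _ _ hs0] at h1 h2
  rw [hc _ _ ht0] at h3 h4
  have h5 : (γ k - γ j) * f t < (γ k - γ j) * f s :=
    mul_lt_mul_of_pos_left (hf ht0 hs0 hlt) (sub_pos.2 (hγ hkj))
  linarith

/-- There is a queue at every late time before a departure. -/
lemma ClearsAt.sum_eq_of_lt (hγ_pos : ∀ k, 0 < γ k) (hf : StrictMonoOn f (Set.Ici 0))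
    (hc : ∀ k s, 0 ≤ s → c k s = γ k * f s) {s t : ℝ} (ht0 : 0 ≤ t) (hts : t < s)
    (hs : ClearsAt μ c x b v s) (ht : ClearsAt μ c x b v t) {k : Fin K}
    (hk : 0 < x k s) : ∑ j, x j t = μ := by
  have hs0 := ht0.trans hts.le
  have h1 := hs.eq_cost k hk
  have h2 := ht.le_cost k
  rw [hc _ _ hs0] at h1
  rw [hc _ _ ht0] at h2
  have h5 : γ k * f t < γ k * f s := mul_lt_mul_of_pos_left (hf ht0 hs0 hts) (hγ_pos k)
  have h6 := hs.delay_nonneg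
  exact ht.queue (by linarith)

lemma lateMass_eq (hlo : lo ≤ 0) (k : Fin K) :
    lateMass (Set.Icc lo hi) x k = ∫ s in Set.Ioc 0 hi, x k s := by
  rw [lateMass]
  congr 2
  ext s
  simp only [Set.mem_inter_iff, Set.mem_Icc, Set.mem_Ioi, Set.mem_Ioc]
  exact ⟨fun h => ⟨h.2, h.1.2⟩, fun h => ⟨⟨hlo.trans h.1.le, h.2⟩, h.1⟩⟩

lemma Ioc_subset_Icc_of_nonpos (hlo : lo ≤ 0) : Set.Ioc 0 hi ⊆ Set.Icc lo hi :=
  fun _ h => ⟨hlo.trans h.1.le, h.2⟩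

lemma IsFeasible.lateMass_nonneg {S : Set ℝ} (h : IsFeasible S μ Q x) (k : Fin K) :
    0 ≤ lateMass S x k :=
  integral_nonneg_of_ae (ae_restrict_of_ae_restrict_of_subset Set.inter_subset_left (h.nonneg k))

lemma integral_indicator_const_Ioc {a r : ℝ} (ha : 0 ≤ a) (har : a ≤ r) (hr : r ≤ hi) (m : ℝ) :
    ∫ s in Set.Ioc 0 hi, (Set.Ioc a r).indicator (fun _ => m) s = m * (r - a) := by
  rw [setIntegral_indicator measurableSet_Ioc,
    Set.inter_eq_right.2 (Set.Ioc_subset_Ioc ha hr)]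
  simp [har, mul_comm]

variable (hμ : 0 < μ) (hlo : lo ≤ 0) (hγ : StrictAnti γ) (hγ_pos : ∀ k, 0 < γ k)
  (hf : StrictMonoOn f (Set.Ici 0)) (hc : ∀ k s, 0 ≤ s → c k s = γ k * f s)
  (h : IsEquilibrium (Set.Icc lo hi) μ Q c x b v)

include hlo h in
lemma IsEquilibrium.integrable_late (k : Fin K) : IntegrableOn (x k) (Set.Ioc 0 hi) :=
  (h.isFeasible.integrable k).mono_set (Ioc_subset_Icc_of_nonpos hlo)

include hμ hlo h in
lemma IsEquilibrium.integral_sum_late (T : Finset (Fin K)) :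
    ∫ s in Set.Ioc 0 hi, ∑ j ∈ T, x j s = μ * ((∑ j ∈ T, lateMass (Set.Icc lo hi) x j) / μ) := by
  rw [mul_div_cancel₀ _ hμ.ne', integral_finsetSum _ fun k _ => h.integrable_late hlo k]
  simp only [lateMass_eq hlo]

include hμ hlo hγ hγ_pos hf hc h in
/-- If group `k` departs at a late time `s`, then the groups up to `k` fill `(0, s)`, so
`s ≤ s_k`, and the groups before `k` have to fit into `(0, s]`, so `s_{k-1} ≤ s`. -/
theorem IsEquilibrium.late_support (k : Fin K) :
    ∀ᵐ s ∂volume.restrict (Set.Ioc 0 hi), x k s ≠ 0 →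
      s ∈ Set.Icc (lateBreak (Set.Icc lo hi) μ x k.castSucc)
        (lateBreak (Set.Icc lo hi) μ x k.succ) := by
  have hcl := ae_restrict_of_ae_restrict_of_subset (Ioc_subset_Icc_of_nonpos hlo) h.ae_clearsAt
  have hint := h.integrable_late hlo
  filter_upwards [hcl, ae_restrict_mem measurableSet_Ioc] with s hs hmem hne
  have hpos : 0 < x k s := lt_of_le_of_ne (hs.flow_nonneg k) hne.symm
  have hval := integral_indicator_const_Ioc le_rfl hmem.1.le hmem.2 μ
  have hind : IntegrableOn ((Set.Ioc 0 s).indicator fun _ => μ) (Set.Ioc 0 hi) :=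
    (integrable_const μ).indicator measurableSet_Ioc
  rw [sub_zero] at hval
  constructor
  · rw [lateBreak, breakpoint_castSucc]
    refine le_of_mul_le_mul_left ?_ hμ
    rw [← h.integral_sum_late hμ hlo, ← hval]
    refine integral_mono_ae (integrable_finsetSum _ fun j _ => hint j) hind ?_
    filter_upwards [hcl, ae_restrict_mem measurableSet_Ioc] with t ht htm
    by_cases hts : t ≤ s
    · rw [Set.indicator_of_mem (show t ∈ Set.Ioc 0 s from ⟨htm.1, hts⟩)]
      exact (Finset.sum_le_sum_of_subset_of_nonneg (Finset.subset_univ _)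
        fun j _ _ => ht.flow_nonneg j).trans ht.capacity
    · rw [Set.indicator_of_notMem fun hm => hts hm.2]
      refine Finset.sum_nonpos fun j hj => not_lt.1 fun hjt => hts ?_
      exact ht.le_of_pos_of_pos hγ hf hc htm.1.le hmem.1.le hs (Finset.mem_Iio.1 hj) hjt hpos
  · rw [lateBreak, breakpoint_succ]
    refine le_of_mul_le_mul_left ?_ hμ
    rw [← h.integral_sum_late hμ hlo, ← hval]
    refine integral_mono_ae hind (integrable_finsetSum _ fun j _ => hint j) ?_
    filter_upwards [hcl, ae_restrict_mem measurableSet_Ioc,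
      (compl_mem_ae_iff.2 (measure_singleton s) : ∀ᵐ t ∂volume.restrict _, t ∉ ({s} : Set ℝ))]
      with t ht htm hne
    by_cases hts : t < s
    · rw [Set.indicator_of_mem (show t ∈ Set.Ioc 0 s from ⟨htm.1, hts.le⟩),
        ← hs.sum_eq_of_lt hγ_pos hf hc htm.1.le hts ht hpos]
      refine (Finset.sum_subset (Finset.subset_univ _) fun j _ hj => ?_).ge
      refine le_antisymm (not_lt.1 fun hjt => hts.not_ge ?_) (ht.flow_nonneg j)
      exact hs.le_of_pos_of_pos hγ hf hc hmem.1.le htm.1.le ht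
        (not_le.1 fun hle => hj (Finset.mem_Iic.2 hle)) hpos hjt
    · rw [Set.indicator_of_notMem fun hm => hts (lt_of_le_of_ne hm.2 hne)]
      exact Finset.sum_nonneg fun j _ => ht.flow_nonneg j

include hμ hlo hγ hγ_pos hf hc h in
/-- A group departs on a non-null part of every subinterval between its breakpoints: it needs all
of the capacity there to serve its late mass. -/
lemma IsEquilibrium.exists_late_pos (k : Fin K) {a r : ℝ}
    (hak : lateBreak (Set.Icc lo hi) μ x k.castSucc ≤ a) (har : a < r)
    (hrk : r ≤ lateBreak (Set.Icc lo hi) μ x k.succ)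
    (hhi : lateBreak (Set.Icc lo hi) μ x k.succ ≤ hi) {P : ℝ → Prop}
    (hP : ∀ᵐ s ∂volume.restrict (Set.Ioc 0 hi), P s) :
    ∃ s ∈ Set.Ioc a r, P s ∧ 0 < x k s := by
  set L := lateBreak (Set.Icc lo hi) μ x k.castSucc with hL
  set R := lateBreak (Set.Icc lo hi) μ x k.succ with hR
  have hL0 : 0 ≤ L := by
    rw [← breakpoint_zero (μ := μ) (X := lateMass (Set.Icc lo hi) x)]
    exact monotone_breakpoint hμ h.isFeasible.lateMass_nonneg (Fin.zero_le _)
  by_contra! hno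
  have hind : ∀ p q : ℝ, IntegrableOn ((Set.Ioc p q).indicator fun _ => μ) (Set.Ioc 0 hi) :=
    fun p q => (integrable_const μ).indicator measurableSet_Ioc
  have hle : ∫ s in Set.Ioc 0 hi, x k s ≤ ∫ s in Set.Ioc 0 hi,
      ((Set.Ioc L R).indicator (fun _ => μ) s - (Set.Ioc a r).indicator (fun _ => μ) s) := by
    refine integral_mono_ae (h.integrable_late hlo k) ((hind L R).sub (hind a r)) ?_
    filter_upwards [hP, h.late_support hμ hlo hγ hγ_pos hf hc k,
      ae_restrict_of_ae_restrict_of_subset (Ioc_subset_Icc_of_nonpos hlo) (h.isFeasible.ae_le k),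
      (compl_mem_ae_iff.2 (measure_singleton L) : ∀ᵐ t ∂volume.restrict _, t ∉ ({L} : Set ℝ))]
      with s hPs hsupp hsle hne
    have hsub : (Set.Ioc a r).indicator (fun _ => μ) s ≤ (Set.Ioc L R).indicator (fun _ => μ) s :=
      Set.indicator_le_indicator_of_subset (Set.Ioc_subset_Ioc hak hrk) (fun _ => hμ.le) s
    by_cases hsa : s ∈ Set.Ioc a r
    · exact (hno s hsa hPs).trans (sub_nonneg.2 hsub)
    · rw [Set.indicator_of_notMem hsa, sub_zero]
      by_cases hx : x k s = 0
      · rw [hx]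
        exact Set.indicator_nonneg (fun _ _ => hμ.le) s
      · have hm := hsupp hx
        rwa [Set.indicator_of_mem
          (show s ∈ Set.Ioc L R from ⟨lt_of_le_of_ne hm.1 (Ne.symm hne), hm.2⟩)]
  rw [integral_sub (hind L R) (hind a r),
    integral_indicator_const_Ioc hL0 (hak.trans (har.le.trans hrk)) hhi,
    integral_indicator_const_Ioc (hL0.trans hak) har.le (hrk.trans hhi),
    ← lateMass_eq hlo] at hle
  have hmass : R = L + lateMass (Set.Icc lo hi) x k / μ := breakpoint_succ_eq_add k
  have hmass' : μ * (R - L) = lateMass (Set.Icc lo hi) x k := by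
    rw [hmass, add_sub_cancel_left, mul_div_cancel₀ _ hμ.ne']
  have := mul_pos hμ (sub_pos.2 har)
  linarith

/-- A group departing at `s` does not envy the next group, nor (if it is the last one) a trip
without cost: the cost difference at `s` is at most the difference of the trip costs. -/
lemma ClearsAt.dropNext_cost_le {s : ℝ} (hs0 : 0 ≤ s) (hc : ∀ k s, 0 ≤ s → c k s = γ k * f s)
    (hs : ClearsAt μ c x b v s) {k : Fin K} (hk : 0 < x k s) :
    dropNext γ k * f s ≤ dropNext v k := by
  have h1 := hs.eq_cost k hk
  rw [hc _ _ hs0] at h1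
  unfold dropNext
  split_ifs with hlt
  · have h2 := hs.le_cost ⟨k.val + 1, hlt⟩
    rw [hc _ _ hs0] at h2
    linarith
  · have := hs.delay_nonneg
    linarith

include hμ hlo hγ hγ_pos hf hc h in
/-- Just before the breakpoint after group `k` that group departs, just after it the next group
departs (or, after the last group, there is no queue). Comparing costs at either time gives the
two inequalities between `v k - v (k + 1)` and the cost difference at the breakpoint. -/
theorem IsEquilibrium.dropNext_late (hstrict : StrictMono (lateBreak (Set.Icc lo hi) μ x))
    (hhi : lateBreak (Set.Icc lo hi) μ x (Fin.last K) < hi)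
    (hfc : ContinuousOn f (Set.Ici 0)) (hg : ∀ k, 0 < dropNext γ k) (k : Fin K) :
    dropNext γ k * f (lateBreak (Set.Icc lo hi) μ x k.succ) = dropNext v k := by
  set s := lateBreak (Set.Icc lo hi) μ x with hs
  have hcl := ae_restrict_of_ae_restrict_of_subset (Ioc_subset_Icc_of_nonpos hlo) h.ae_clearsAt
  have hs0 : s 0 = 0 := breakpoint_zero
  have hnn : ∀ i, 0 ≤ s i := fun i => hs0 ▸ hstrict.monotone (Fin.zero_le i)
  have hle : ∀ i, s i ≤ hi := fun i => (hstrict.monotone (Fin.le_last i)).trans hhi.le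
  have hcont : ContinuousWithinAt (fun t => dropNext γ k * f t) (Set.Ici 0) (s k.succ) :=
    (hfc _ (hnn _)).const_mul _
  have hpos : 0 < s k.succ := hs0 ▸ hstrict (Fin.succ_pos k)
  have hmono : ∀ {p q}, 0 ≤ p → p ≤ q → dropNext γ k * f p ≤ dropNext γ k * f q :=
    fun hp hpq => mul_le_mul_of_nonneg_left (hf.monotoneOn hp (hp.trans hpq) hpq) (hg k).le
  apply le_antisymm
  · have hlim : Filter.Tendsto (fun t => dropNext γ k * f t) (nhdsWithin (s k.succ)
        (Set.Ioo (s k.castSucc) (s k.succ))) (nhds (dropNext γ k * f (s k.succ))) :=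
      hcont.mono fun t ht => (hnn _).trans ht.1.le
    have hlt : s k.castSucc < s k.succ := hstrict (Fin.castSucc_lt_succ)
    have : (nhdsWithin (s k.succ) (Set.Ioo (s k.castSucc) (s k.succ))).NeBot :=
      right_nhdsWithin_Ioo_neBot hlt
    refine le_of_tendsto hlim ?_
    filter_upwards [self_mem_nhdsWithin] with t ht
    obtain ⟨u, hu, hcu, hxu⟩ := h.exists_late_pos hμ hlo hγ hγ_pos hf hc k ht.1.le ht.2 le_rfl
      (hle _) hcl
    have ht0 : 0 ≤ t := (hnn _).trans ht.1.le
    exact (hmono ht0 hu.1.le).trans (hcu.dropNext_cost_le (ht0.trans hu.1.le) hc hxu)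
  · by_cases hlt : k.val + 1 < K
    · set j : Fin K := ⟨k.val + 1, hlt⟩ with hj
      have hjk : j.castSucc = k.succ := by ext; simp [hj]
      have hsj : s k.succ < s j.succ := hjk ▸ hstrict (Fin.castSucc_lt_succ)
      have hlim : Filter.Tendsto (fun t => dropNext γ k * f t) (nhdsWithin (s k.succ)
          (Set.Ioo (s k.succ) (s j.succ))) (nhds (dropNext γ k * f (s k.succ))) :=
        hcont.mono fun t ht => hpos.le.trans ht.1.le
      have : (nhdsWithin (s k.succ) (Set.Ioo (s k.succ) (s j.succ))).NeBot :=
        left_nhdsWithin_Ioo_neBot hsj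
      refine ge_of_tendsto hlim ?_
      filter_upwards [self_mem_nhdsWithin] with t ht
      obtain ⟨u, hu, hcu, hxu⟩ := h.exists_late_pos hμ hlo hγ hγ_pos hf hc j
        (a := s k.succ) (r := t) (by rw [hjk]) ht.1 ht.2.le (hle _) hcl
      have hu0 : 0 ≤ u := hpos.le.trans hu.1.le
      refine le_trans ?_ (hmono hu0 hu.2)
      have h1 := hcu.eq_cost j hxu
      have h2 := hcu.le_cost k
      rw [hc _ _ hu0] at h1 h2
      simp only [dropNext, dif_pos hlt]
      linarith
    · have hlast : k.succ = Fin.last K := by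
        ext
        simp only [Fin.val_succ, Fin.val_last]
        omega
      have hlim : Filter.Tendsto (fun t => dropNext γ k * f t) (nhdsWithin (s k.succ)
          (Set.Ioo (s k.succ) hi)) (nhds (dropNext γ k * f (s k.succ))) :=
        hcont.mono fun t ht => hpos.le.trans ht.1.le
      have : (nhdsWithin (s k.succ) (Set.Ioo (s k.succ) hi)).NeBot :=
        left_nhdsWithin_Ioo_neBot (hlast ▸ hhi)
      refine ge_of_tendsto hlim ?_
      filter_upwards [self_mem_nhdsWithin] with t ht
      obtain ⟨u, ⟨hcu, hsu⟩, hu⟩ : ∃ u, (ClearsAt μ c x b v u ∧ ∀ j, x j u ≠ 0 →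
          u ∈ Set.Icc (s j.castSucc) (s j.succ)) ∧ u ∈ Set.Ioc (s k.succ) t := by
        have hsub : Set.Ioc (s k.succ) t ⊆ Set.Ioc 0 hi :=
          Set.Ioc_subset_Ioc hpos.le ht.2.le
        have hae := ae_restrict_of_ae_restrict_of_subset hsub
          (hcl.and (ae_all_iff.2 (h.late_support hμ hlo hγ hγ_pos hf hc)))
        have : Filter.NeBot (ae (volume.restrict (Set.Ioc (s k.succ) t))) := by
          rw [ae_neBot, Ne, Measure.restrict_eq_zero, Real.volume_Ioc, ENNReal.ofReal_eq_zero]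
          linarith [ht.1]
        exact (hae.and (ae_restrict_mem measurableSet_Ioc)).exists
      have hu0 : 0 ≤ u := hpos.le.trans hu.1.le
      -- nobody departs at `u`, so the capacity is not used up and there is no queue
      have hx0 : ∀ j, x j u = 0 := fun j => by
        by_contra hne
        exact (hu.1.trans_le (hsu j hne).2).not_ge
          (hlast ▸ hstrict.monotone (Fin.le_last j.succ))
      have hb0 : b u = 0 := le_antisymm (not_lt.1 fun hb => hμ.ne (by
        rw [← hcu.queue hb]; simp [hx0])) hcu.delay_nonneg
      refine le_trans ?_ (hmono hu0 hu.2)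
      have h2 := hcu.le_cost k
      rw [hc _ _ hu0, hb0] at h2
      simp only [dropNext, dif_neg hlt]
      linarith

end Late

/-! ### The early side by time reversal -/

section Reflection

variable {K : ℕ} {μ : ℝ} {Q : Fin K → ℝ} {c x : Fin K → ℝ → ℝ} {b : ℝ → ℝ}
  {v : Fin K → ℝ} {lo hi : ℝ}

lemma measurePreserving_neg_Icc (lo hi : ℝ) :
    MeasurePreserving (fun s : ℝ => -s) (volume.restrict (Set.Icc (-hi) (-lo)))
      (volume.restrict (Set.Icc lo hi)) := by
  have := (Measure.measurePreserving_neg (volume : Measure ℝ)).restrict_preimage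
    (measurableSet_Icc (a := lo) (b := hi))
  have hpre : Neg.neg ⁻¹' Set.Icc lo hi = Set.Icc (-hi) (-lo) := by simp
  rwa [hpre] at this

/-- Reversing time turns equilibria into equilibria. -/
lemma IsEquilibrium.reflect (h : IsEquilibrium (Set.Icc lo hi) μ Q c x b v) :
    IsEquilibrium (Set.Icc (-hi) (-lo)) μ Q (fun k s => c k (-s)) (fun k s => x k (-s))
      (fun s => b (-s)) v := by
  have hmp := measurePreserving_neg_Icc lo hi
  refine .of_ae_clearsAt
    (fun k => (h.measurable k).comp_quasiMeasurePreserving hmp.quasiMeasurePreserving)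
    (fun k => ?_) ?_
  · rw [← h.conservation k]
    exact hmp.integral_comp (MeasurableEquiv.neg ℝ).measurableEmbedding (x k)
  · filter_upwards [hmp.quasiMeasurePreserving.ae h.ae_clearsAt] with s hs
    exact ⟨hs.flow_nonneg, hs.delay_nonneg, hs.le_cost, hs.eq_cost, hs.capacity, hs.queue⟩

lemma lateMass_reflect :
    lateMass (Set.Icc (-hi) (-lo)) (fun k s => x k (-s)) = earlyMass (Set.Icc lo hi) x := by
  ext k
  have hpre : Set.Icc (-hi) (-lo) ∩ Set.Ioi 0 =
      (fun s : ℝ => -s) ⁻¹' (Set.Icc lo hi ∩ Set.Iio 0) := by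
    ext s
    simp [and_comm]
  rw [lateMass, earlyMass, hpre]
  refine ((Measure.measurePreserving_neg (volume : Measure ℝ)).setIntegral_preimage_emb
    (MeasurableEquiv.neg ℝ).measurableEmbedding (x k) _).trans ?_
  exact setIntegral_congr_set ((ae_eq_refl _).inter Iio_ae_eq_Iic)

lemma lateBreak_reflect :
    lateBreak (Set.Icc (-hi) (-lo)) μ (fun k s => x k (-s)) = earlyBreak (Set.Icc lo hi) μ x := by
  rw [lateBreak, lateMass_reflect, earlyBreak]

lemma earlyMass_add_lateMass {S : Set ℝ} [IsFiniteMeasure (volume.restrict S)]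
    (h : IsFeasible S μ Q x) (k : Fin K) : earlyMass S x k + lateMass S x k = Q k := by
  rw [earlyMass, lateMass, ← h.conservation k, ← Set.compl_Iic, ← Set.sdiff_eq]
  exact integral_inter_add_sdiff measurableSet_Iic (h.integrable k)

end Reflection

/-! ### Schedule delay costs -/

section Cost

variable {K : ℕ} {β γ : Fin K → ℝ} {fe fl : ℝ → ℝ}

lemma scheduleCost_of_nonneg (hfe : fe 0 = 0) (hfl : fl 0 = 0) (k : Fin K) {s : ℝ} (hs : 0 ≤ s) :
    scheduleCost β γ fe fl k s = γ k * fl s := by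
  rcases hs.eq_or_lt with rfl | hs
  · simp [scheduleCost, hfe, hfl]
  · simp [scheduleCost, hs.not_ge]

lemma scheduleCost_of_nonpos (k : Fin K) {s : ℝ} (hs : s ≤ 0) :
    scheduleCost β γ fe fl k s = β k * fe s := by
  simp [scheduleCost, hs]

lemma continuous_scheduleCost (hfe_cont : ContinuousOn fe (Set.Iic 0)) (hfe : fe 0 = 0)
    (hfl_cont : ContinuousOn fl (Set.Ici 0)) (hfl : fl 0 = 0) (k : Fin K) :
    Continuous (scheduleCost β γ fe fl k) := by
  have heq : scheduleCost β γ fe fl k =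
      fun s => β k * fe (min s 0) + γ k * fl (max s 0) := by
    ext s
    rcases le_total s 0 with hs | hs
    · simp [scheduleCost_of_nonpos, hs, hfl]
    · simp [scheduleCost_of_nonneg hfe hfl, hs, hfe]
  rw [heq]
  exact (continuous_const.mul (hfe_cont.comp_continuous (by fun_prop) fun s => min_le_right s 0)).add
    (continuous_const.mul (hfl_cont.comp_continuous (by fun_prop) fun s => le_max_right s 0))

lemma scheduleCost_nonneg (hβ : ∀ k, 0 < β k) (hγ : ∀ k, 0 < γ k)
    (hfe_anti : StrictAntiOn fe (Set.Iic 0)) (hfe : fe 0 = 0)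
    (hfl_mono : StrictMonoOn fl (Set.Ici 0)) (hfl : fl 0 = 0) (k : Fin K) (s : ℝ) :
    0 ≤ scheduleCost β γ fe fl k s := by
  rcases le_total s 0 with hs | hs
  · rw [scheduleCost_of_nonpos k hs]
    exact mul_nonneg (hβ k).le (hfe ▸ hfe_anti.antitoneOn hs Set.self_mem_Iic hs)
  · rw [scheduleCost_of_nonneg hfe hfl k hs]
    exact mul_nonneg (hγ k).le (hfl ▸ hfl_mono.monotoneOn Set.self_mem_Ici hs hs)

/-- A function proportional to `fe` at early and to `fl` at late times takes each value at most
once on either side of `0`. -/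
lemma ae_ne_of_injOn (hfe : Set.InjOn fe (Set.Iic 0)) (hfl : Set.InjOn fl (Set.Ici 0))
    {p q : ℝ} (hp : p ≠ 0) (hq : q ≠ 0) {g : ℝ → ℝ} (hge : ∀ s ≤ 0, g s = p * fe s)
    (hgl : ∀ s, 0 ≤ s → g s = q * fl s) (w : ℝ) : ∀ᵐ s, g s ≠ w := by
  have he : ({s | s ≤ 0 ∧ g s = w} : Set ℝ).Subsingleton := by
    rintro s ⟨hs, hsw⟩ t ⟨ht, htw⟩
    refine hfe hs ht (mul_left_cancel₀ hp ?_)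
    rw [← hge s hs, ← hge t ht, hsw, htw]
  have hl : ({s | 0 ≤ s ∧ g s = w} : Set ℝ).Subsingleton := by
    rintro s ⟨hs, hsw⟩ t ⟨ht, htw⟩
    refine hfl hs ht (mul_left_cancel₀ hq ?_)
    rw [← hgl s hs, ← hgl t ht, hsw, htw]
  filter_upwards [compl_mem_ae_iff.2 (he.measure_zero volume),
    compl_mem_ae_iff.2 (hl.measure_zero volume)]
    with s h1 h2 hs
  exact (le_total s 0).elim (fun h => h1 ⟨h, hs⟩) fun h => h2 ⟨h, hs⟩

lemma dropNext_pos {w : Fin K → ℝ} (hw : StrictAnti w) (hw_pos : ∀ k, 0 < w k) (k : Fin K) :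
    0 < dropNext w k := by
  unfold dropNext
  split_ifs with h
  · exact sub_pos.2 (hw (Fin.mk_lt_mk.2 k.val.lt_succ_self))
  · simpa using hw_pos k

/-- Moving a given total from the early to the late side raises the late cost and lowers the
early one, so the two are balanced at one point only. -/
lemma eq_of_balanced (hfe_anti : StrictAntiOn fe (Set.Iic 0))
    (hfl_mono : StrictMonoOn fl (Set.Ici 0)) {d g : ℝ} (hd : 0 < d) (hg : 0 < g)
    {p q p' q' : ℝ} (hp : 0 ≤ p) (hq : 0 ≤ q) (hp' : 0 ≤ p') (hq' : 0 ≤ q')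
    (hsum : q + p = q' + p') (h : d * fe (-p) = g * fl q) (h' : d * fe (-p') = g * fl q') :
    p = p' := by
  have key : ∀ {p q p' q' : ℝ}, 0 ≤ p → 0 ≤ p' → 0 ≤ q' → q + p = q' + p' → 0 ≤ q →
      d * fe (-p) = g * fl q → d * fe (-p') = g * fl q' → ¬ p < p' := by
    intro p q p' q' hp hp' hq' hsum hq h h' hlt
    have h1 : fe (-p) < fe (-p') :=
      hfe_anti (neg_nonpos.2 hp') (neg_nonpos.2 hp) (neg_lt_neg hlt)
    have h2 : fl q' < fl q := hfl_mono hq' hq (by linarith)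
    have h3 := mul_lt_mul_of_pos_left h1 hd
    have h4 := mul_lt_mul_of_pos_left h2 hg
    linarith
  exact le_antisymm (not_lt.1 (key hp' hp hq hsum.symm hq' h' h))
    (not_lt.1 (key hp hp' hq' hsum hq h h'))

end Cost

end Bottleneck

open Bottleneck

theorem proposition6p5 {K : ℕ} (μ : ℝ) (hμ : 0 < μ)
    (Q : Fin K → ℝ) (hQ : ∀ k, 0 ≤ Q k)
    (β γ : Fin K → ℝ)
    (hβ : StrictAnti β) (hβ_pos : ∀ k, 0 < β k)
    (hγ : StrictAnti γ) (hγ_pos : ∀ k, 0 < γ k)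
    (fe fl : ℝ → ℝ)
    (hfe_cont : ContinuousOn fe (Set.Iic 0)) (hfe_anti : StrictAntiOn fe (Set.Iic 0))
    (hfe_zero : fe 0 = 0)
    (hfl_cont : ContinuousOn fl (Set.Ici 0)) (hfl_mono : StrictMonoOn fl (Set.Ici 0))
    (hfl_zero : fl 0 = 0)
    (S : Set ℝ) (sLo sHi : ℝ) (hS : S = Set.Icc sLo sHi)
    (hLo : sLo ≤ -((∑ k, Q k) / μ)) (hHi : (∑ k, Q k) / μ ≤ sHi)
    (c : Fin K → ℝ → ℝ) (hc : c = Bottleneck.scheduleCost β γ fe fl) :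
    -- the optimal solutions are exactly the equilibrium flow patterns
    (∀ x, Bottleneck.IsOptimal S μ Q c x ↔ ∃ b v, Bottleneck.IsEquilibrium S μ Q c x b v) ∧
    -- existence and uniqueness (up to null sets)
    (∃ x, Bottleneck.IsOptimal S μ Q c x ∧
      ∀ y, Bottleneck.IsOptimal S μ Q c y → ∀ k, ∀ᵐ s ∂volume.restrict S, y k s = x k s) ∧
    ∀ x, Bottleneck.IsOptimal S μ Q c x →
      -- two-sided sorting
      ((∀ k : Fin K, ∀ᵐ s ∂volume.restrict S, x k s ≠ 0 →
          s ∈ Set.Icc (-Bottleneck.earlyBreak S μ x k.succ)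
                (-Bottleneck.earlyBreak S μ x k.castSucc) ∪
              Set.Icc (Bottleneck.lateBreak S μ x k.castSucc)
                (Bottleneck.lateBreak S μ x k.succ)) ∧
        Bottleneck.earlyBreak S μ x 0 = 0 ∧ Monotone (Bottleneck.earlyBreak S μ x) ∧
        Bottleneck.earlyBreak S μ x (Fin.last K) = (∑ k, Bottleneck.earlyMass S x k) / μ ∧
        Bottleneck.lateBreak S μ x 0 = 0 ∧ Monotone (Bottleneck.lateBreak S μ x) ∧
        Bottleneck.lateBreak S μ x (Fin.last K) = (∑ k, Bottleneck.lateMass S x k) / μ) ∧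
      -- equations determining the breakpoints of an interior solution
      (StrictMono (Bottleneck.earlyBreak S μ x) → StrictMono (Bottleneck.lateBreak S μ x) →
        ∀ k : Fin K,
          Bottleneck.lateBreak S μ x k.succ + Bottleneck.earlyBreak S μ x k.succ
            = ∑ j ∈ Finset.Iic k, Q j / μ ∧
          Bottleneck.dropNext β k * fe (-Bottleneck.earlyBreak S μ x k.succ)
            = Bottleneck.dropNext γ k * fl (Bottleneck.lateBreak S μ x k.succ) ∧
          (∀ b v, Bottleneck.IsEquilibrium S μ Q c x b v →
            Bottleneck.dropNext γ k * fl (Bottleneck.lateBreak S μ x k.succ)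
              = Bottleneck.dropNext v k) ∧
          (∀ p q : ℝ, 0 ≤ p → 0 ≤ q → q + p = ∑ j ∈ Finset.Iic k, Q j / μ →
            Bottleneck.dropNext β k * fe (-p) = Bottleneck.dropNext γ k * fl q →
            p = Bottleneck.earlyBreak S μ x k.succ ∧
              q = Bottleneck.lateBreak S μ x k.succ)) := by
  subst hS hc
  set c := scheduleCost β γ fe fl with hc
  set S := Set.Icc sLo sHi with hS
  have hQμ : 0 ≤ (∑ k, Q k) / μ := div_nonneg (Finset.sum_nonneg fun k _ => hQ k) hμ.le
  have hlo : sLo ≤ 0 := hLo.trans (neg_nonpos.2 hQμ)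
  have hhi : 0 ≤ sHi := hQμ.trans hHi
  have hint : ∀ k, IntegrableOn (c k) S := fun k =>
    (continuous_scheduleCost hfe_cont hfe_zero hfl_cont hfl_zero k).continuousOn.integrableOn_compact
      isCompact_Icc
  have hc0 : ∀ k s, 0 ≤ c k s :=
    scheduleCost_nonneg hβ_pos hγ_pos hfe_anti hfe_zero hfl_mono hfl_zero
  have hcl : ∀ k s, 0 ≤ s → c k s = γ k * fl s := fun k s hs =>
    scheduleCost_of_nonneg hfe_zero hfl_zero k hs
  have hce : ∀ k s, s ≤ 0 → c k s = β k * fe s := fun k s hs => scheduleCost_of_nonpos k hs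
  have hnull : ∀ k w, ∀ᵐ s ∂volume.restrict S, c k s ≠ w := fun k w =>
    ae_restrict_of_ae (ae_ne_of_injOn hfe_anti.injOn hfl_mono.injOn (hβ_pos k).ne' (hγ_pos k).ne'
      (hce k) (hcl k) w)
  have hnull₂ : ∀ k j, j ≠ k → ∀ w, ∀ᵐ s ∂volume.restrict S, c k s - c j s ≠ w :=
    fun k j hj w => ae_restrict_of_ae (ae_ne_of_injOn hfe_anti.injOn hfl_mono.injOn
      (p := β k - β j) (q := γ k - γ j) (sub_ne_zero.2 (hβ.injective.ne hj.symm))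
      (sub_ne_zero.2 (hγ.injective.ne hj.symm))
      (fun s hs => by rw [hce k s hs, hce j s hs]; ring)
      (fun s hs => by rw [hcl k s hs, hcl j s hs]; ring) w)
  obtain ⟨x₀, b₀, v₀, h₀⟩ : ∃ x b v, IsEquilibrium S μ Q c x b v := by
    refine exists_isEquilibrium hμ hint hc0 hnull hnull₂ hQ fun hpos => ?_
    have := div_pos hpos hμ
    rw [hS, Real.volume_real_Icc_of_le (hlo.trans hhi)]
    linarith
  have hopt : ∀ {x}, IsOptimal S μ Q c x → IsEquilibrium S μ Q c x b₀ v₀ :=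
    fun hx => hx.isEquilibrium hint h₀
  -- the early side of an equilibrium is the late side of the time-reversed one
  have hfeR : StrictMonoOn (fun s => fe (-s)) (Set.Ici 0) := fun s hs t ht hst =>
    hfe_anti (Set.mem_Iic.2 (neg_nonpos.2 ht)) (Set.mem_Iic.2 (neg_nonpos.2 hs)) (neg_lt_neg hst)
  have hfeR_cont : ContinuousOn (fun s => fe (-s)) (Set.Ici 0) :=
    hfe_cont.comp continuous_neg.continuousOn fun s hs => Set.mem_Iic.2 (neg_nonpos.2 hs)
  have hcR : ∀ k s, 0 ≤ s → c k (-s) = β k * fe (-s) := fun k s hs => hce k _ (neg_nonpos.2 hs)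
  have hloR : -sHi ≤ 0 := neg_nonpos.2 hhi
  refine ⟨fun x => ⟨fun hx => ⟨b₀, v₀, hopt hx⟩, fun ⟨b, v, h⟩ => h.isOptimal hint⟩,
    ⟨x₀, h₀.isOptimal hint, fun y hy k => hy.ae_eq hint hnull hnull₂ h₀ k⟩, fun x hx => ?_⟩
  have hE := hopt hx
  have hlate : ∀ k, 0 ≤ lateMass S x k := hx.1.lateMass_nonneg
  have hearly : ∀ k, 0 ≤ earlyMass S x k := by
    rw [hS, ← lateMass_reflect]
    exact hE.reflect.isFeasible.lateMass_nonneg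
  have hsum : ∀ k, lateMass S x k + earlyMass S x k = Q k := fun k => by
    rw [add_comm, earlyMass_add_lateMass hx.1 k]
  have he_mono : Monotone (earlyBreak S μ x) := monotone_breakpoint hμ hearly
  have hl_mono : Monotone (lateBreak S μ x) := monotone_breakpoint hμ hlate
  have he_zero : earlyBreak S μ x 0 = 0 := breakpoint_zero
  have hl_zero : lateBreak S μ x 0 = 0 := breakpoint_zero
  refine ⟨⟨fun k => ?_, he_zero, he_mono, breakpoint_last, hl_zero, hl_mono, breakpoint_last⟩,
    fun he_strict hl_strict k => ?_⟩
  · have h1 := (ae_restrict_iff' measurableSet_Ioc).1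
      (hE.late_support hμ hlo hγ hγ_pos hfl_mono hcl k)
    have h2 := (ae_restrict_iff' measurableSet_Ioc).1
      (hE.reflect.late_support hμ hloR hβ hβ_pos hfeR hcR k)
    rw [lateBreak_reflect] at h2
    have h3 := (Measure.measurePreserving_neg (volume : Measure ℝ)).quasiMeasurePreserving.ae h2
    filter_upwards [ae_restrict_of_ae h1, ae_restrict_of_ae h3, ae_restrict_mem measurableSet_Icc,
      (compl_mem_ae_iff.2 (measure_singleton 0) : ∀ᵐ t ∂volume.restrict _, t ∉ ({0} : Set ℝ))]
      with s hs1 hs2 hsS hs0 hne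
    rcases lt_or_gt_of_ne hs0 with hs | hs
    · have := hs2 ⟨neg_pos.2 hs, neg_le_neg hsS.1⟩ (by rwa [neg_neg])
      exact Or.inl ⟨neg_le.1 this.2, le_neg.1 this.1⟩
    · exact Or.inr (hs1 ⟨hs, hsS.2⟩ hne)
  · have hlast : lateBreak S μ x (Fin.last K) + earlyBreak S μ x (Fin.last K)
        = (∑ k, Q k) / μ := by
      rw [lateBreak, earlyBreak, breakpoint_last, breakpoint_last, ← add_div,
        ← Finset.sum_add_distrib, Finset.sum_congr rfl fun j _ => hsum j]
    have hK : (0 : Fin (K + 1)) < Fin.last K := (Fin.succ_pos k).trans_le (Fin.le_last _)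
    have hl_pos := hl_strict hK
    have he_pos := he_strict hK
    rw [hl_zero] at hl_pos
    rw [he_zero] at he_pos
    have hγd := dropNext_pos hγ hγ_pos
    have hβd := dropNext_pos hβ hβ_pos
    have hL : ∀ b v, IsEquilibrium S μ Q c x b v →
        dropNext γ k * fl (lateBreak S μ x k.succ) = dropNext v k := fun b v h =>
      h.dropNext_late hμ hlo hγ hγ_pos hfl_mono hcl hl_strict (show _ < sHi by linarith)
        hfl_cont hγd k
    have hEarly : dropNext β k * fe (-earlyBreak S μ x k.succ) = dropNext v₀ k := by
      have := hE.reflect.dropNext_late hμ hloR hβ hβ_pos hfeR hcR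
        (by rwa [lateBreak_reflect]) (by rw [lateBreak_reflect]; linarith) hfeR_cont hβd k
      rwa [lateBreak_reflect] at this
    have hbal := hEarly.trans (hL _ _ hE).symm
    have htot : lateBreak S μ x k.succ + earlyBreak S μ x k.succ
        = ∑ j ∈ Finset.Iic k, Q j / μ := by
      rw [lateBreak, earlyBreak, breakpoint_succ, breakpoint_succ, ← add_div,
        ← Finset.sum_add_distrib, Finset.sum_congr rfl fun j _ => hsum j, Finset.sum_div]
    refine ⟨htot, hbal, hL, fun p q hp hq hpq heq => ?_⟩
    have hp' : p = earlyBreak S μ x k.succ :=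
      eq_of_balanced hfe_anti hfl_mono (hβd k) (hγd k) hp hq
        (he_zero ▸ he_mono (Fin.zero_le _)) (hl_zero ▸ hl_mono (Fin.zero_le _))
        (hpq.trans htot.symm) heq hbal
    exact ⟨hp', by linarith⟩
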